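/- **Setting.** For a discrete-time signal $x:\mathbb Z\to\mathbb C$ write $\|x\|_2^2=\sum_n|x[n]|^2$ and let $X(f)=\sum_n x[n]e^{-j2\pi fn}$ be its discrete-time Fourier transform. For a positive integer $N$, $\mathcal T_N$ sets all entries of a signal outside $\{0,\dots,N-1\}$ to zero. For $0<W<\frac12$ and $f_c\in\mathbb R$, $\mathcal B_{f_c,W}$ is the orthogonal projection that restricts the DTFT to the band $[f_c-W,f_c+W]$ (modulo $1$), i.e. $(\mathcal B_{f_c,W}x)[n]=\int_{f_c-W}^{f_c+W}X(f)e^{j2\pi fn}\,df$; put $\mathcal B_W=\mathcal B_{0,W}$. The Discrete Prolate Spheroidal Sequences (DPSS's) are real sequences $s^{(0)}_{N,W},\dots,s^{(N-1)}_{N,W}$ on $\mathbb Z$ which, with eigenvalues $1>\lambda^{(0)}_{N,W}>\dots>\lambda^{(N-1)}_{N,W}>0$, satisfy $\mathcal B_W(\mathcal T_N(s^{(\ell)}_{N,W}))=\lambda^{(\ell)}_{N,W}s^{(\ell)}_{N,W}$ and $\|\mathcal T_N(s^{(\ell)}_{N,W})\|_2=1$. Let $S_{N,W}$ be the $N\times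 N$ matrix whose $\ell$-th column is the restriction of $s^{(\ell)}_{N,W}$ to $\{0,\dots,N-1\}$, and let $E_{f_c}$ be the diagonal $N\times N$ matrix with entries $e^{j2\pi f_cm}$, $m=0,\dots,N-1$. **Theorem.** There is an absolute constant $C_3>0$ such that for all fixed $W\in(0,\frac12)$ and $\epsilon\in(0,\frac1{2W}-1)$ there are a constant $C_4>0$ and an integer $N_1$, depending only on $W$ and $\epsilon$, such that for all $N\ge N_1$: 1. $\lambda^{(\ell)}_{N,W}\le C_3e^{-C_4N}$ for all $\ell\in\{0,\dots,N-1\}$ with $\ell\ge 2NW(1+\epsilon)$; and 2. with the same constants: let $f_c,\delta\in\mathbb R$ and let $x=\mathcal T_N(x)$ be a time-limited signal with $$\|\mathcal B_{f_c,W}x\|_2^2\ge(1-\delta)\|x\|_2^2 .$$ Let $\mathbf x\in\mathbb C^N$ be the vector formed by restricting $x$ to the indices $0,\dots,N-1$, set $k=\lceil 2NW(1+\epsilon)\rceil$, let $Q=[E_{f_c}S_{N,W}]_k$ be the matrix formed by the first $k$ columns of $E_{f_c}S_{N,W}$, and let $P_Q$ be the orthogonal projection onto its column space. Then $$\|\mathbf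 x-P_Q\mathbf x\|_2^2\le\bigl(\delta+N\,C_3e^{-C_4N}\bigr)\|\mathbf x\|_2^2 .$$ -/

import Mathlib

open scoped BigOperators

noncomputable section

namespace DPSS

/-- The energy `‖x‖₂² = ∑ₙ |x[n]|²` of a discrete-time signal. -/
def energy (x : ℤ → ℂ) : ℝ := ∑' n : ℤ, ‖x n‖ ^ 2

/-- The discrete-time Fourier transform `X(f) = ∑ₙ x[n] e^{-j2πfn}`. -/
def dtft (x : ℤ → ℂ) (f : ℝ) : ℂ :=
  ∑' n : ℤ, x n * Complex.exp (-(2 * Real.pi * f * n * Complex.I))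

/-- The time-limiting operator `𝒯_N`: it sets all entries outside `{0, …, N - 1}` to zero. -/
def timeLimit (N : ℕ) (x : ℤ → ℂ) : ℤ → ℂ :=
  fun n => if 0 ≤ n ∧ n < (N : ℤ) then x n else 0

/-- The band-limiting operator `𝓑_{f_c,W}`: the DTFT is cut off to the band `[f_c - W, f_c + W]`
(of length `2 W < 1`, inside one period of the DTFT) and transformed back to the time domain,
`(𝓑_{f_c,W} x)[n] = ∫_{f_c - W}^{f_c + W} X(f) e^{j2πfn} df`.
It is only ever applied to finitely supported signals, where the DTFT is a finite sum. The
operator `𝓑_W` is the case `f_c = 0`. -/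
def bandLimit (fc W : ℝ) (x : ℤ → ℂ) : ℤ → ℂ :=
  fun n => ∫ f in (fc - W)..(fc + W), dtft x f * Complex.exp (2 * Real.pi * f * n * Complex.I)

/-- `s 0, …, s (N - 1)` are the Discrete Prolate Spheroidal Sequences with parameters `N` and `W`,
with eigenvalues `1 > lam 0 ≥ … ≥ lam (N - 1) > 0`.

The eigenvalues are in fact known to be pairwise distinct. This fact is not built into the
definition: the eigenvalues are only listed in non-increasing order, and in case of a repeated
eigenvalue its eigenvectors have to be chosen orthogonal on `{0, …, N - 1}`. Families with
`lam 0 > … > lam (N - 1)` satisfy the clauses `antitone` and `orthogonal_of_eq` automatically,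
see `IsDPSS.of_strictAnti`. -/
structure IsDPSS (N : ℕ) (W : ℝ) (s : Fin N → ℤ → ℝ) (lam : Fin N → ℝ) : Prop where
  lt_one : ∀ l, lam l < 1
  pos : ∀ l, 0 < lam l
  antitone : Antitone lam
  eigen : ∀ l, bandLimit 0 W (timeLimit N (fun n => (s l n : ℂ))) =
    fun n => (lam l : ℂ) * (s l n : ℂ)
  normalized : ∀ l, energy (timeLimit N (fun n => (s l n : ℂ))) = 1
  orthogonal_of_eq : ∀ l l', l ≠ l' → lam l = lam l' → ∑ n : Fin N, s l n * s l' n = 0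

/-- The `N × N` matrix `S_{N,W}` whose columns are the DPSS vectors, that is, the restrictions of
the sequences `s 0, …, s (N - 1)` to `{0, …, N - 1}`. -/
def dpssMatrix {N : ℕ} (s : Fin N → ℤ → ℝ) : Matrix (Fin N) (Fin N) ℂ :=
  Matrix.of fun n l => ((s l (n : ℤ) : ℝ) : ℂ)

/-- The diagonal modulation matrix `E_{f_c}` with diagonal entries `e^{j2πf_c m}`. -/
def modulator (N : ℕ) (fc : ℝ) : Matrix (Fin N) (Fin N) ℂ :=
  Matrix.diagonal fun m => Complex.exp (2 * Real.pi * fc * (m : ℕ) * Complex.I)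

/-- The column space of `[A]_k`, the matrix formed by the first `k` columns of `A`. -/
def firstColumnsSpan {N : ℕ} (A : Matrix (Fin N) (Fin N) ℂ) (k : ℕ) :
    Submodule ℂ (EuclideanSpace ℂ (Fin N)) :=
  Submodule.span ℂ {v | ∃ l : Fin N, (l : ℕ) < k ∧ v = WithLp.toLp 2 (A.col l)}

/-- The vector in `ℂ^N` of the entries of `x` with indices `0, …, N - 1`. -/
def restrict (N : ℕ) (x : ℤ → ℂ) : EuclideanSpace ℂ (Fin N) :=
  WithLp.toLp 2 fun n : Fin N => x (n : ℤ)

/-- Strictly ordered eigenvalues: the last clause of `IsDPSS` is void. -/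
theorem IsDPSS.of_strictAnti {N : ℕ} {W : ℝ} {s : Fin N → ℤ → ℝ} {lam : Fin N → ℝ}
    (h1 : ∀ l, lam l < 1) (h0 : ∀ l, 0 < lam l) (hanti : StrictAnti lam)
    (heig : ∀ l, bandLimit 0 W (timeLimit N (fun n => (s l n : ℂ))) =
      fun n => (lam l : ℂ) * (s l n : ℂ))
    (hnorm : ∀ l, energy (timeLimit N (fun n => (s l n : ℂ))) = 1) :
    IsDPSS N W s lam :=
  ⟨h1, h0, hanti.antitone, heig, hnorm, fun _ _ hne he => absurd (hanti.injective he) hne⟩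

/-! ### Existence of the sequences -/

/-- The convolution kernel of `𝓑_W`. -/
def ker (W : ℝ) (j : ℤ) : ℝ := ∫ f in (-W)..W, Real.cos (2 * Real.pi * f * j)

theorem ker_neg (W : ℝ) (j : ℤ) : ker W (-j) = ker W j := by
  unfold ker
  congr 1
  ext f
  rw [← Real.cos_neg]
  congr 1
  push_cast
  ring

theorem integral_exp_eq_ker (W : ℝ) (j : ℤ) :
    ∫ f in (-W)..W, Complex.exp (2 * Real.pi * f * j * Complex.I) = (ker W j : ℂ) := by
  have hs : ∫ f in (-W)..W, Real.sin (2 * Real.pi * f * j) = 0 := by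
    have h := intervalIntegral.integral_comp_neg (a := -W) (b := W)
      (fun f : ℝ => Real.sin (2 * Real.pi * f * j))
    have h2 : ∀ f : ℝ, Real.sin (2 * Real.pi * (-f) * j) = - Real.sin (2 * Real.pi * f * j) := by
      intro f
      rw [← Real.sin_neg]
      congr 1
      ring
    simp only [h2, intervalIntegral.integral_neg, neg_neg] at h
    linarith
  have he : ∀ f : ℝ, Complex.exp (2 * Real.pi * f * j * Complex.I) =
      ((Real.cos (2 * Real.pi * f * j) : ℝ) : ℂ)
        + ((Real.sin (2 * Real.pi * f * j) : ℝ) : ℂ) * Complex.I := by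
    intro f
    rw [Complex.exp_mul_I]
    push_cast
    rfl
  simp only [he]
  rw [intervalIntegral.integral_add, intervalIntegral.integral_mul_const,
    intervalIntegral.integral_ofReal, intervalIntegral.integral_ofReal, hs]
  · simp [ker]
  · exact Continuous.intervalIntegrable (by fun_prop) _ _
  · exact Continuous.intervalIntegrable (by fun_prop) _ _

theorem tsum_timeLimit {E : Type*} [AddCommMonoid E] [TopologicalSpace E] (N : ℕ) (g : ℤ → E)
    (hg : ∀ n : ℤ, ¬ (0 ≤ n ∧ n < (N : ℤ)) → g n = 0) :
    ∑' n : ℤ, g n = ∑ m : Fin N, g (m : ℤ) := by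
  rw [tsum_eq_sum (s := Finset.Ico (0 : ℤ) N)]
  · rw [← Fin.sum_univ_eq_sum_range (fun m : ℕ => g (m : ℤ)) N |>.symm]
    symm
    refine Finset.sum_bij (fun (m : ℕ) _ => (m : ℤ)) ?_ ?_ ?_ ?_
    · intro a ha
      simp at ha ⊢
      exact ha
    · intro a _ b _ h
      exact_mod_cast h
    · intro b hb
      simp at hb
      exact ⟨b.toNat, by simp; omega, by simp; omega⟩
    · intro a _
      rfl
  · intro b hb
    apply hg
    simpa using hb

theorem bandLimit_timeLimit (N : ℕ) (W : ℝ) (v : ℤ → ℝ) (n : ℤ) :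
    bandLimit 0 W (timeLimit N (fun n => (v n : ℂ))) n =
      ((∑ m : Fin N, ker W (n - m) * v m : ℝ) : ℂ) := by
  have hd : ∀ f : ℝ, dtft (timeLimit N (fun n => (v n : ℂ))) f *
      Complex.exp (2 * Real.pi * f * n * Complex.I) =
      ∑ m : Fin N, Complex.exp (2 * Real.pi * f * ((n - m : ℤ) : ℂ) * Complex.I) * (v m : ℂ) := by
    intro f
    unfold dtft
    rw [tsum_timeLimit N, Finset.sum_mul]
    · refine Finset.sum_congr rfl fun m _ => ?_
      have : (0 : ℤ) ≤ m ∧ (m : ℤ) < N := by have := m.2; omega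
      simp only [timeLimit, this, and_self, if_true]
      rw [mul_assoc, ← Complex.exp_add, mul_comm]
      congr 2
      push_cast
      ring
    · intro m hm
      simp [timeLimit, hm]
  unfold bandLimit
  simp only [hd, zero_sub, zero_add]
  rw [intervalIntegral.integral_finsetSum]
  · push_cast
    refine Finset.sum_congr rfl fun m _ => ?_
    rw [intervalIntegral.integral_mul_const]
    congr 1
    have := integral_exp_eq_ker W (n - m)
    push_cast at this
    exact this
  · intro m _
    exact Continuous.intervalIntegrable (by fun_prop) _ _

/-- `|V(f)|²` for the DTFT `V` of the vector `v`. -/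
def pow2 {N : ℕ} (v : Fin N → ℝ) (f : ℝ) : ℝ :=
  (∑ n : Fin N, v n * Real.cos (2 * Real.pi * f * (n : ℕ))) ^ 2 +
    (∑ n : Fin N, v n * Real.sin (2 * Real.pi * f * (n : ℕ))) ^ 2

theorem continuous_pow2 {N : ℕ} (v : Fin N → ℝ) : Continuous (pow2 v) := by
  unfold pow2
  fun_prop

theorem quad_eq {N : ℕ} (W : ℝ) (v : Fin N → ℝ) :
    ∑ n : Fin N, v n * ∑ m : Fin N, ker W ((n : ℤ) - m) * v m = ∫ f in (-W)..W, pow2 v f := by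
  have hp : ∀ f, pow2 v f = ∑ n : Fin N, ∑ m : Fin N,
      Real.cos (2 * Real.pi * f * (((n : ℤ) - (m : ℤ) : ℤ) : ℝ)) * (v n * v m) := by
    intro f
    unfold pow2
    rw [sq, sq, Finset.sum_mul_sum, Finset.sum_mul_sum, ← Finset.sum_add_distrib]
    refine Finset.sum_congr rfl fun n _ => ?_
    rw [← Finset.sum_add_distrib]
    refine Finset.sum_congr rfl fun m _ => ?_
    push_cast
    rw [mul_sub, Real.cos_sub]
    ring
  simp only [hp]
  rw [intervalIntegral.integral_finsetSum]
  · refine Finset.sum_congr rfl fun n _ => ?_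
    rw [intervalIntegral.integral_finsetSum, Finset.mul_sum]
    · refine Finset.sum_congr rfl fun m _ => ?_
      rw [intervalIntegral.integral_mul_const, ker]
      ring
    · intro m _
      exact Continuous.intervalIntegrable (by fun_prop) _ _
  · intro m _
    exact Continuous.intervalIntegrable (by fun_prop) _ _

theorem exists_pow2_pos {N : ℕ} {v : Fin N → ℝ} (hv : v ≠ 0) {a b : ℝ} (hab : a < b)
    (hb : b < a + 1) : ∃ f ∈ Set.Icc a b, 0 < pow2 v f := by
  by_contra! hcon
  apply hv
  set p : Polynomial ℂ := ∑ n : Fin N, Polynomial.monomial (n : ℕ) (v n : ℂ) with hpdef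
  have hroot : ∀ f ∈ Set.Icc a b, p.IsRoot (Complex.exp (2 * Real.pi * f * Complex.I)) := by
    intro f hf
    have h := hcon f hf
    unfold pow2 at h
    have h1 : ∑ n : Fin N, v n * Real.cos (2 * Real.pi * f * (n : ℕ)) = 0 := by
      nlinarith [sq_nonneg (∑ n : Fin N, v n * Real.cos (2 * Real.pi * f * (n : ℕ))),
        sq_nonneg (∑ n : Fin N, v n * Real.sin (2 * Real.pi * f * (n : ℕ)))]
    have h2 : ∑ n : Fin N, v n * Real.sin (2 * Real.pi * f * (n : ℕ)) = 0 := by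
      nlinarith [sq_nonneg (∑ n : Fin N, v n * Real.cos (2 * Real.pi * f * (n : ℕ))),
        sq_nonneg (∑ n : Fin N, v n * Real.sin (2 * Real.pi * f * (n : ℕ)))]
    have h3 : p.eval (Complex.exp (2 * Real.pi * f * Complex.I)) =
        ((∑ n : Fin N, v n * Real.cos (2 * Real.pi * f * (n : ℕ)) : ℝ) : ℂ) +
        ((∑ n : Fin N, v n * Real.sin (2 * Real.pi * f * (n : ℕ)) : ℝ) : ℂ) * Complex.I := by
      rw [hpdef, Polynomial.eval_finsetSum]
      push_cast
      rw [Finset.sum_mul, ← Finset.sum_add_distrib]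
      refine Finset.sum_congr rfl fun n _ => ?_
      rw [Polynomial.eval_monomial, ← Complex.exp_nat_mul]
      rw [show ((n : ℕ) : ℂ) * (2 * Real.pi * f * Complex.I) =
        (2 * Real.pi * f * ((n : ℕ) : ℂ)) * Complex.I by ring, Complex.exp_mul_I]
      ring
    rw [Polynomial.IsRoot, h3, h1, h2]
    simp
  have hinj : Set.InjOn (fun f : ℝ => Complex.exp (2 * Real.pi * f * Complex.I))
      (Set.Icc a b) := by
    intro f hf g hg h
    obtain ⟨n, hn⟩ := Complex.exp_eq_exp_iff_exists_int.1 h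
    have h2 : (f : ℂ) = g + n := by
      have : (2 * Real.pi * Complex.I : ℂ) ≠ 0 := Complex.two_pi_I_ne_zero
      apply mul_left_cancel₀ this
      linear_combination hn
    have h3 : f = g + n := by exact_mod_cast h2
    have h4 : (n : ℝ) < 1 := by linarith [hf.1, hf.2, hg.1, hg.2]
    have h5 : (-1 : ℝ) < n := by linarith [hf.1, hf.2, hg.1, hg.2]
    have h6 : n < 1 := by exact_mod_cast h4
    have h7 : -1 < n := by exact_mod_cast h5
    have h8 : n = 0 := by omega
    simp [h3, h8]
  have hp0 : p = 0 := by
    apply Polynomial.eq_zero_of_infinite_isRoot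
    refine Set.Infinite.mono ?_ ((Set.Icc_infinite hab).image hinj)
    rintro _ ⟨f, hf, rfl⟩
    exact hroot f hf
  funext n
  have hc := congrArg (fun q => Polynomial.coeff q (n : ℕ)) hp0
  simp only [hpdef, Polynomial.finsetSum_coeff, Polynomial.coeff_monomial,
    Polynomial.coeff_zero] at hc
  simp only [Fin.val_inj] at hc
  simpa using hc

theorem integral_pow2_pos {N : ℕ} {v : Fin N → ℝ} (hv : v ≠ 0) {a b : ℝ} (hab : a < b)
    (hb : b < a + 1) : 0 < ∫ f in a..b, pow2 v f := by
  obtain ⟨c, hc, hpos⟩ := exists_pow2_pos hv hab hb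
  exact intervalIntegral.integral_pos hab (continuous_pow2 v).continuousOn
    (fun f _ => by unfold pow2; positivity) ⟨c, hc, hpos⟩

theorem ker_half (j : ℤ) : ker (1 / 2) j = if j = 0 then 1 else 0 := by
  unfold ker
  split_ifs with h
  · subst h
    norm_num
  · have hj : (j : ℝ) ≠ 0 := by exact_mod_cast h
    have : ∀ f : ℝ, Real.cos (2 * Real.pi * f * j) = Real.cos ((2 * Real.pi * j) * f) := by
      intro f
      congr 1
      ring
    simp only [this]
    rw [intervalIntegral.integral_comp_mul_left _ (by positivity)]
    have e1 : 2 * Real.pi * (j : ℝ) * (1 / 2) = j * Real.pi := by ring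
    have e2 : 2 * Real.pi * (j : ℝ) * (-(1 / 2)) = -(j * Real.pi) := by ring
    rw [integral_cos, e1, e2, Real.sin_neg, Real.sin_int_mul_pi]
    simp

theorem integral_pow2_half {N : ℕ} (v : Fin N → ℝ) :
    ∫ f in (-(1 / 2))..(1 / 2), pow2 v f = ∑ n, v n ^ 2 := by
  rw [← quad_eq]
  refine Finset.sum_congr rfl fun n _ => ?_
  have : ∀ m : Fin N, ker (1 / 2) ((n : ℤ) - m) * v m = if n = m then v m else 0 := by
    intro m
    rw [ker_half]
    by_cases h : n = m
    · simp [h]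
    · have : ¬ ((n : ℤ) - m = 0) := by
        intro h'
        apply h
        ext
        omega
      simp [h, this]
  simp only [this]
  simp [sq]

/-- For `0 < W < 1/2` the Discrete Prolate Spheroidal Sequences exist. -/
theorem exists_isDPSS (N : ℕ) {W : ℝ} (hW0 : 0 < W) (hW : W < 1 / 2) :
    ∃ s lam, IsDPSS N W s lam := by
  set A : Matrix (Fin N) (Fin N) ℝ := Matrix.of fun n m => ker W ((n : ℤ) - m) with hAdef
  have hA : A.IsHermitian := by
    ext n m
    simp only [hAdef, Matrix.conjTranspose_apply, Matrix.of_apply, star_trivial]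
    rw [← ker_neg]
    congr 1
    ring
  set σ := Tuple.sort (fun i => - hA.eigenvalues i) with hσ
  set lam : Fin N → ℝ := fun l => hA.eigenvalues (σ l) with hlam
  set v : Fin N → Fin N → ℝ := fun l => ⇑(hA.eigenvectorBasis (σ l)) with hvdef
  have heig : ∀ l n, ∑ m : Fin N, ker W ((n : Fin N) - m) * v l m = lam l * v l n := by
    intro l n
    have := congrFun (hA.mulVec_eigenvectorBasis (σ l)) n
    simpa [Matrix.mulVec, dotProduct, hAdef, hvdef, hlam] using this
  have horth : ∀ l l', ∑ n : Fin N, v l n * v l' n = if l = l' then 1 else 0 := by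
    intro l l'
    have h := orthonormal_iff_ite.1 hA.eigenvectorBasis.orthonormal (σ l) (σ l')
    rw [PiLp.inner_apply] at h
    simp only [EmbeddingLike.apply_eq_iff_eq] at h
    rw [← h]
    refine Finset.sum_congr rfl fun n _ => ?_
    simp [hvdef, mul_comm]
  have hv0 : ∀ l, v l ≠ 0 := by
    intro l h
    have := horth l l
    simp [h] at this
  have hq : ∀ l, lam l = ∫ f in (-W)..W, pow2 (v l) f := by
    intro l
    rw [← quad_eq]
    simp only [heig]
    have := horth l l
    simp only [if_true] at this
    calc lam l = lam l * ∑ n, v l n * v l n := by rw [this, mul_one]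
      _ = _ := by
        rw [Finset.mul_sum]
        exact Finset.sum_congr rfl fun n _ => by ring
  have hpos : ∀ l, 0 < lam l := by
    intro l
    rw [hq]
    exact integral_pow2_pos (hv0 l) (by linarith) (by linarith)
  have hlt : ∀ l, lam l < 1 := by
    intro l
    have h1 := horth l l
    simp only [if_true, ← sq] at h1
    rw [← integral_pow2_half] at h1
    have hi : ∀ a b, IntervalIntegrable (pow2 (v l)) MeasureTheory.volume a b :=
      fun a b => (continuous_pow2 _).intervalIntegrable a b
    have h2 := intervalIntegral.integral_add_adjacent_intervals (hi (-(1 / 2)) (-W)) (hi (-W) W)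
    have h3 := intervalIntegral.integral_add_adjacent_intervals (hi (-(1 / 2)) W) (hi W (1 / 2))
    have h4 := integral_pow2_pos (hv0 l) (a := -(1 / 2)) (b := -W) (by linarith) (by linarith)
    have h5 := integral_pow2_pos (hv0 l) (a := W) (b := 1 / 2) (by linarith) (by linarith)
    rw [hq]
    linarith
  set s : Fin N → ℤ → ℝ := fun l n => (lam l)⁻¹ * ∑ m : Fin N, ker W (n - m) * v l m with hs
  have hsv : ∀ l (n : Fin N), s l n = v l n := by
    intro l n
    simp only [hs]
    rw [heig, inv_mul_cancel_left₀ (hpos l).ne']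
  refine ⟨s, lam, hlt, hpos, ?_, ?_, ?_, ?_⟩
  · intro i j hij
    have := Tuple.monotone_sort (fun i => - hA.eigenvalues i) hij
    simpa [hlam, hσ] using this
  · intro l
    funext n
    rw [bandLimit_timeLimit]
    simp only [hsv]
    rw [← Complex.ofReal_mul]
    congr 1
    simp only [hs]
    rw [mul_inv_cancel_left₀ (hpos l).ne']
  · intro l
    unfold energy
    rw [tsum_timeLimit N]
    · have h1 := horth l l
      simp only [if_true] at h1
      rw [← h1]
      refine Finset.sum_congr rfl fun n _ => ?_
      have : (0 : ℤ) ≤ n ∧ (n : ℤ) < N := by have := n.2; omega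
      simp only [timeLimit, this, and_self, if_true]
      rw [hsv]
      simp [sq]
    · intro n hn
      simp [timeLimit, hn]
  · intro l l' hne _
    simp only [hsv]
    rw [horth]
    simp [hne]

end DPSS

end

namespace DPSS

/-! ### Orthonormality and the quadratic form -/

/-! The DPSS vectors are orthonormal, and their transforms are orthogonal on the band with squared
norms `lam l`. So a vector with coefficients `c` has energy `∑ ‖c l‖ ^ 2`, of which `∑ lam l * ‖c l‖
^ 2` lies in the band (`IsDPSS.sum_norm_sq`, `IsDPSS.integral_norm_sq`).

Decay of the eigenvalues is a min-max argument. Some nonzero combination of the vectors `0, …, l`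
has a DTFT vanishing at `l` prescribed frequencies. Take these to be the points near the band of a
uniform grid with `M` points per period, `M` slightly larger than `N`. The surplus `M - N` leaves
room to multiply the associated polynomial by a power of a short averaging kernel peaked at a point
of the band; interpolation on the grid then sees only points where this power is exponentially small
(`norm_eval_le_of_vanish`). The combination thus has exponentially little energy in the band, which
bounds `lam l` (`IsDPSS.lam_le`, `exists_exp_decay`).

For the approximation, demodulate `x` and expand it in the DPSS basis. The projection error is at
most the energy of the coefficients with index at least `k`, and these carry almost no energy in the
band, so the energy outside the band controls them (`approximation_error_le`). -/

theorem IsDPSS.sum_ker_mul {N : ℕ} {W : ℝ} {s : Fin N → ℤ → ℝ} {lam : Fin N → ℝ}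
    (h : IsDPSS N W s lam) (l : Fin N) (n : ℤ) :
    ∑ m : Fin N, ker W (n - m) * s l m = lam l * s l n := by
  have h1 := congrFun (h.eigen l) n
  rw [bandLimit_timeLimit] at h1
  exact_mod_cast h1

theorem energy_timeLimit (N : ℕ) (x : ℤ → ℂ) :
    energy (timeLimit N x) = ∑ n : Fin N, ‖x n‖ ^ 2 := by
  unfold energy
  rw [tsum_timeLimit N]
  · refine Finset.sum_congr rfl fun n _ => ?_
    have : (0 : ℤ) ≤ n ∧ (n : ℤ) < N := by have := n.2; omega
    simp only [timeLimit, this, and_self, if_true]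
  · intro n hn
    simp [timeLimit, hn]

theorem IsDPSS.sum_mul {N : ℕ} {W : ℝ} {s : Fin N → ℤ → ℝ} {lam : Fin N → ℝ}
    (h : IsDPSS N W s lam) (l l' : Fin N) :
    ∑ n : Fin N, s l n * s l' n = if l = l' then 1 else 0 := by
  split_ifs with hl
  · subst hl
    have h1 := h.normalized l
    rw [energy_timeLimit] at h1
    rw [← h1]
    refine Finset.sum_congr rfl fun n _ => ?_
    simp [sq]
  · by_cases he : lam l = lam l'
    · exact h.orthogonal_of_eq l l' hl he
    · have h1 : ∑ n : Fin N, (lam l * s l n) * s l' n =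
          ∑ n : Fin N, s l n * (lam l' * s l' n) := by
        simp only [← h.sum_ker_mul, Finset.sum_mul, Finset.mul_sum]
        rw [Finset.sum_comm]
        refine Finset.sum_congr rfl fun n _ => Finset.sum_congr rfl fun m _ => ?_
        rw [← ker_neg, neg_sub]
        ring
      have h2 : (lam l - lam l') * ∑ n : Fin N, s l n * s l' n = 0 := by
        rw [sub_mul, Finset.mul_sum, Finset.mul_sum, sub_eq_zero]
        simpa only [mul_assoc, mul_left_comm] using h1
      exact (mul_eq_zero.1 h2).resolve_left (sub_ne_zero.2 he)

/-- The DTFT of a vector indexed by `0, …, N - 1`. -/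
noncomputable def vecDtft {N : ℕ} (v : Fin N → ℂ) (f : ℝ) : ℂ :=
  ∑ n : Fin N, v n * Complex.exp (-(2 * Real.pi * f * (n : ℕ) * Complex.I))

theorem continuous_vecDtft {N : ℕ} (v : Fin N → ℂ) : Continuous (vecDtft v) := by
  unfold vecDtft
  fun_prop

theorem vecDtft_sum {N : ℕ} {ι : Type*} [Fintype ι] (c : ι → ℂ) (u : ι → Fin N → ℂ) (f : ℝ) :
    vecDtft (fun n => ∑ l, c l * u l n) f = ∑ l, c l * vecDtft (u l) f := by
  unfold vecDtft
  simp only [Finset.sum_mul, Finset.mul_sum]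
  rw [Finset.sum_comm]
  simp only [mul_assoc]

theorem integral_vecDtft_mul_conj {N : ℕ} (W : ℝ) (u v : Fin N → ℝ) :
    ∫ f in (-W)..W, vecDtft (fun n => (u n : ℂ)) f *
      (starRingEnd ℂ) (vecDtft (fun n => (v n : ℂ)) f) =
      ((∑ m : Fin N, v m * ∑ n : Fin N, ker W ((m : ℤ) - n) * u n : ℝ) : ℂ) := by
  have hp : ∀ f : ℝ, vecDtft (fun n => (u n : ℂ)) f *
      (starRingEnd ℂ) (vecDtft (fun n => (v n : ℂ)) f) = ∑ m : Fin N, ∑ n : Fin N,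
        Complex.exp (2 * Real.pi * f * (((m : ℤ) - n : ℤ) : ℂ) * Complex.I) *
          ((u n : ℂ) * (v m : ℂ)) := by
    intro f
    unfold vecDtft
    rw [map_sum, Finset.sum_mul_sum, Finset.sum_comm]
    refine Finset.sum_congr rfl fun m _ => Finset.sum_congr rfl fun n _ => ?_
    rw [map_mul, ← Complex.exp_conj]
    simp only [map_neg, map_mul, Complex.conj_ofReal, Complex.conj_I, map_natCast, map_ofNat]
    have : (2 * Real.pi * f * (((m : ℤ) - n : ℤ) : ℂ) * Complex.I : ℂ) =
        -(2 * Real.pi * f * (n : ℕ) * Complex.I) +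
          -(2 * Real.pi * f * (m : ℕ) * -Complex.I) := by
      push_cast
      ring
    rw [this, Complex.exp_add]
    ring
  simp only [hp]
  rw [intervalIntegral.integral_finsetSum]
  · rw [Complex.ofReal_sum]
    refine Finset.sum_congr rfl fun m _ => ?_
    rw [intervalIntegral.integral_finsetSum, Finset.mul_sum, Complex.ofReal_sum]
    · refine Finset.sum_congr rfl fun n _ => ?_
      rw [intervalIntegral.integral_mul_const, integral_exp_eq_ker, Complex.ofReal_mul,
        Complex.ofReal_mul]
      ring
    · intro n _
      exact Continuous.intervalIntegrable (by fun_prop) _ _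
  · intro m _
    exact Continuous.intervalIntegrable (by fun_prop) _ _

theorem IsDPSS.integral_norm_sq {N : ℕ} {W : ℝ} {s : Fin N → ℤ → ℝ} {lam : Fin N → ℝ}
    (h : IsDPSS N W s lam) (c : Fin N → ℂ) :
    ∫ f in (-W)..W, ‖vecDtft (fun n : Fin N => ∑ l, c l * (s l n : ℂ)) f‖ ^ 2 =
      ∑ l, lam l * ‖c l‖ ^ 2 := by
  have key : ∀ l l', ∫ f in (-W)..W, vecDtft (fun n : Fin N => (s l n : ℂ)) f *
      (starRingEnd ℂ) (vecDtft (fun n : Fin N => (s l' n : ℂ)) f) =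
        if l' = l then (lam l : ℂ) else 0 := by
    intro l l'
    rw [integral_vecDtft_mul_conj W (fun n => s l n) (fun n => s l' n)]
    simp only [h.sum_ker_mul]
    have h1 := congrArg (lam l * ·) (h.sum_mul l' l)
    simp only [Finset.mul_sum] at h1
    rw [Finset.sum_congr rfl fun m : Fin N => fun _ => mul_left_comm (s l' m) (lam l) (s l m), h1]
    split_ifs <;> simp
  have hc : ∀ l, Continuous (vecDtft (fun n : Fin N => (s l n : ℂ))) :=
    fun l => continuous_vecDtft _
  have hcc : ∀ l, Continuous fun f => (starRingEnd ℂ) (vecDtft (fun n : Fin N => (s l n : ℂ)) f) :=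
    fun l => Complex.continuous_conj.comp (hc l)
  have hC : ((∫ f in (-W)..W, ‖vecDtft (fun n : Fin N => ∑ l, c l * (s l n : ℂ)) f‖ ^ 2 : ℝ) : ℂ) =
      ((∑ l, lam l * ‖c l‖ ^ 2 : ℝ) : ℂ) := by
    rw [← intervalIntegral.integral_ofReal]
    have hp : ∀ f : ℝ, ((‖vecDtft (fun n : Fin N => ∑ l, c l * (s l n : ℂ)) f‖ ^ 2 : ℝ) : ℂ) =
        ∑ l, ∑ l', (c l * (starRingEnd ℂ) (c l')) * (vecDtft (fun n : Fin N => (s l n : ℂ)) f *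
          (starRingEnd ℂ) (vecDtft (fun n : Fin N => (s l' n : ℂ)) f)) := by
      intro f
      push_cast
      rw [← Complex.mul_conj', vecDtft_sum c (fun l (n : Fin N) => (s l n : ℂ)), map_sum,
        Finset.sum_mul_sum]
      refine Finset.sum_congr rfl fun l _ => Finset.sum_congr rfl fun l' _ => ?_
      rw [map_mul]
      ring
    simp only [hp]
    rw [intervalIntegral.integral_finsetSum]
    · push_cast
      refine Finset.sum_congr rfl fun l _ => ?_
      rw [intervalIntegral.integral_finsetSum]
      · simp only [intervalIntegral.integral_const_mul, key]
        simp [Complex.mul_conj', mul_comm]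
      · intro l' _
        exact (continuous_const.mul ((hc l).mul (hcc l'))).intervalIntegrable _ _
    · intro l _
      exact (continuous_finsetSum _ fun l' _ =>
        continuous_const.mul ((hc l).mul (hcc l'))).intervalIntegrable _ _
  exact_mod_cast hC

theorem IsDPSS.sum_norm_sq {N : ℕ} {W : ℝ} {s : Fin N → ℤ → ℝ} {lam : Fin N → ℝ}
    (h : IsDPSS N W s lam) (c : Fin N → ℂ) :
    ∑ n : Fin N, ‖∑ l, c l * (s l n : ℂ)‖ ^ 2 = ∑ l, ‖c l‖ ^ 2 := by
  have hC : ((∑ n : Fin N, ‖∑ l, c l * (s l n : ℂ)‖ ^ 2 : ℝ) : ℂ) =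
      ((∑ l, ‖c l‖ ^ 2 : ℝ) : ℂ) := by
    push_cast
    have hp : ∀ n : Fin N, ((‖∑ l, c l * (s l n : ℂ)‖ : ℂ)) ^ 2 =
        ∑ l, ∑ l', (c l * (starRingEnd ℂ) (c l')) * ((s l n * s l' n : ℝ) : ℂ) := by
      intro n
      rw [← Complex.mul_conj', map_sum, Finset.sum_mul_sum]
      refine Finset.sum_congr rfl fun l _ => Finset.sum_congr rfl fun l' _ => ?_
      rw [map_mul, Complex.conj_ofReal]
      push_cast
      ring
    simp only [hp]
    rw [Finset.sum_comm]
    refine Finset.sum_congr rfl fun l _ => ?_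
    rw [Finset.sum_comm]
    have h2 : ∀ l', ∑ n : Fin N, c l * (starRingEnd ℂ) (c l') * ((s l n * s l' n : ℝ) : ℂ) =
        c l * (starRingEnd ℂ) (c l') * if l = l' then 1 else 0 := by
      intro l'
      rw [← Finset.mul_sum, ← Complex.ofReal_sum, h.sum_mul]
      split_ifs <;> simp
    simp only [h2]
    simp [Complex.mul_conj']
  exact_mod_cast hC

/-! ### Trigonometric interpolation -/

/-- Discrete Fourier inversion: for degree below `M` there is no aliasing. -/
theorem coeff_mul_eq_sum_eval_pow {M : ℕ} {ζ : ℂ} (hζ : IsPrimitiveRoot ζ M)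
    {g : Polynomial ℂ} (hg : g.natDegree < M) {n : ℕ} (hn : n < M) :
    g.coeff n * M = ∑ k ∈ Finset.range M, g.eval (ζ ^ k) * (ζ⁻¹ ^ n) ^ k := by
  have h0 : ζ ≠ 0 := hζ.ne_zero (by omega)
  have hgeom : ∀ i < M, ∑ k ∈ Finset.range M, (ζ ^ i * ζ⁻¹ ^ n) ^ k =
      if i = n then (M : ℂ) else 0 := by
    intro i hi
    split_ifs with h
    · subst h
      simp [h0]
    · have h1 : ζ ^ i * ζ⁻¹ ^ n ≠ 1 := by
        intro h1
        apply h
        apply hζ.pow_inj hi hn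
        rw [inv_pow] at h1
        exact mul_inv_eq_one₀ (pow_ne_zero _ h0) |>.1 h1
      rw [geom_sum_eq h1, mul_pow, ← pow_mul, ← pow_mul, mul_comm i, mul_comm n, pow_mul, pow_mul,
        inv_pow, hζ.pow_eq_one]
      simp
  have he : ∀ k, g.eval (ζ ^ k) * (ζ⁻¹ ^ n) ^ k =
      ∑ i ∈ Finset.range M, g.coeff i * (ζ ^ i * ζ⁻¹ ^ n) ^ k := by
    intro k
    rw [Polynomial.eval_eq_sum_range' hg, Finset.sum_mul]
    refine Finset.sum_congr rfl fun i _ => ?_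
    rw [mul_pow, ← pow_mul, ← pow_mul, mul_comm k i]
    ring
  simp only [he]
  rw [Finset.sum_comm]
  simp only [← Finset.mul_sum]
  rw [Finset.sum_congr rfl fun i hi => by rw [hgeom i (Finset.mem_range.1 hi)]]
  simp [hn]

/-- Each coefficient is at most the mean of the sampled moduli, and there are at most `M`
coefficients. The crude constant is harmless against exponential decay. -/
theorem norm_eval_le_sum_eval_pow {M : ℕ} {ζ : ℂ} (hζ : IsPrimitiveRoot ζ M)
    {g : Polynomial ℂ} (hg : g.natDegree < M) {z : ℂ} (hz : ‖z‖ = 1) :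
    ‖g.eval z‖ ≤ ∑ k ∈ Finset.range M, ‖g.eval (ζ ^ k)‖ := by
  have hM : (0 : ℝ) < M := by exact_mod_cast (by omega : 0 < M)
  have hζ1 : ‖ζ‖ = 1 := hζ.norm'_eq_one (by omega)
  have hc : ∀ n ∈ Finset.range M, ‖g.coeff n * z ^ n‖ ≤
      (∑ k ∈ Finset.range M, ‖g.eval (ζ ^ k)‖) / M := by
    intro n hn
    rw [norm_mul, norm_pow, hz, one_pow, mul_one, le_div_iff₀ hM]
    have h1 := congrArg norm (coeff_mul_eq_sum_eval_pow hζ hg (Finset.mem_range.1 hn))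
    rw [norm_mul, Complex.norm_natCast] at h1
    rw [h1]
    refine (norm_sum_le _ _).trans (Finset.sum_le_sum fun k _ => ?_)
    simp [hζ1]
  rw [Polynomial.eval_eq_sum_range' hg]
  refine (norm_sum_le _ _).trans ((Finset.sum_le_sum hc).trans ?_)
  rw [Finset.sum_const, Finset.card_range, nsmul_eq_mul, mul_div_cancel₀ _ hM.ne']

/-- The damping polynomial of length `b`, normalized at `z`. -/
noncomputable def damping (b : ℕ) (z : ℂ) : Polynomial ℂ :=
  ∑ i ∈ Finset.range b, Polynomial.monomial i ((z⁻¹) ^ i / b)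

theorem eval_damping (b : ℕ) (z w : ℂ) :
    (damping b z).eval w = (∑ i ∈ Finset.range b, (w / z) ^ i) / b := by
  unfold damping
  rw [Polynomial.eval_finsetSum, Finset.sum_div]
  refine Finset.sum_congr rfl fun i _ => ?_
  rw [Polynomial.eval_monomial, div_pow, inv_pow]
  ring

theorem natDegree_damping_le (b : ℕ) (z : ℂ) : (damping b z).natDegree ≤ b - 1 := by
  unfold damping
  refine Polynomial.natDegree_sum_le_of_forall_le _ _ fun i hi => ?_
  refine (Polynomial.natDegree_monomial_le _).trans ?_
  have := Finset.mem_range.1 hi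
  omega

theorem eval_damping_self {b : ℕ} (hb : 0 < b) {z : ℂ} (hz : z ≠ 0) :
    (damping b z).eval z = 1 := by
  rw [eval_damping, div_self hz]
  have : (b : ℂ) ≠ 0 := by exact_mod_cast hb.ne'
  simp [this]

theorem norm_geom_sum_le {w : ℂ} (hw : ‖w‖ = 1) {d : ℝ} (hd : 0 < d) (h : d ≤ ‖w - 1‖) (b : ℕ) :
    ‖∑ i ∈ Finset.range b, w ^ i‖ ≤ 2 / d := by
  have h1 : w ≠ 1 := by
    rintro rfl
    simp at h
    linarith
  rw [geom_sum_eq h1, norm_div]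
  have h2 : ‖w ^ b - 1‖ ≤ 2 := by
    refine (norm_sub_le _ _).trans ?_
    rw [norm_pow, hw, one_pow, norm_one]
    norm_num
  exact div_le_div₀ (by norm_num) h2 hd h

/-- A point at distance at least `η` from the integers is mapped to a point of the circle at
distance at least `4 η` from `1`. -/
theorem le_norm_exp_sub_one {η t : ℝ} (h : ∀ m : ℤ, η ≤ |t - m|) :
    4 * η ≤ ‖Complex.exp (2 * Real.pi * t * Complex.I) - 1‖ := by
  set d : ℝ := t - round t with hd
  have h1 : |d| ≤ 1 / 2 := abs_sub_round t
  have h2 : η ≤ |d| := h (round t)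
  have h3 : Complex.exp (2 * Real.pi * t * Complex.I) =
      Complex.exp (Complex.I * ((2 * Real.pi * d : ℝ) : ℂ)) := by
    rw [Complex.exp_eq_exp_iff_exists_int]
    refine ⟨round t, ?_⟩
    rw [hd]
    push_cast
    ring
  rw [h3, Complex.norm_exp_I_mul_ofReal_sub_one, norm_mul, Real.norm_eq_abs, Real.norm_eq_abs,
    show 2 * Real.pi * d / 2 = Real.pi * d by ring]
  have hpi := Real.pi_pos
  have h4 : |Real.pi * d| ≤ Real.pi / 2 := by
    rw [abs_mul, abs_of_pos hpi]
    nlinarith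
  have h5 := Real.mul_abs_le_abs_sin h4
  -- Jordan's inequality `2 / π * |x| ≤ |sin x|` at `x = π d` gives `2 |d| ≤ |sin (π d)|`.
  rw [abs_mul, abs_of_pos hpi, ← mul_assoc, div_mul_cancel₀ _ hpi.ne'] at h5
  rw [abs_of_pos (by norm_num : (0 : ℝ) < 2)]
  linarith

/-- If a polynomial of degree less than `N` vanishes at all points of a uniform grid of the circle
that are `η`-close to `z`, then it is small at `z`. -/
theorem norm_eval_le_of_vanish {N b L M : ℕ} (hb : 0 < b) (hM : M = N + (b - 1) * L)
    {ζ : ℂ} (hζ : IsPrimitiveRoot ζ M) {p : Polynomial ℂ} (hp : p.natDegree < N) {z : ℂ}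
    (hz : ‖z‖ = 1) {d A : ℝ} (hd : 0 < d) (hA : ∀ w : ℂ, ‖w‖ = 1 → ‖p.eval w‖ ≤ A)
    (hv : ∀ k, p.eval (ζ ^ k) = 0 ∨ d ≤ ‖ζ ^ k / z - 1‖) :
    ‖p.eval z‖ ≤ M * (A * (2 / d / b) ^ L) := by
  have hz0 : z ≠ 0 := by
    rintro rfl
    simp at hz
  have hζ1 : ‖ζ‖ = 1 := hζ.norm'_eq_one (by omega)
  -- The surplus `(b - 1) * L` of grid points is exactly the degree available for the damping
  -- factor.
  have hdeg : (p * damping b z ^ L).natDegree < M := by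
    refine Polynomial.natDegree_mul_le.trans_lt ?_
    have h1 := Polynomial.natDegree_pow_le (p := damping b z) (n := L)
    have h2 := Nat.mul_le_mul_left L (natDegree_damping_le b z)
    rw [mul_comm L (b - 1)] at h2
    omega
  have h1 := norm_eval_le_sum_eval_pow hζ hdeg hz
  -- The damping factor equals `1` at `z`, so the value to be bounded is unchanged.
  rw [Polynomial.eval_mul, Polynomial.eval_pow, eval_damping_self hb hz0, one_pow, mul_one] at h1
  refine h1.trans ?_
  have hA0 : 0 ≤ A := (norm_nonneg _).trans (hA z hz)
  have h2 : ∀ k ∈ Finset.range M, ‖(p * damping b z ^ L).eval (ζ ^ k)‖ ≤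
      A * (2 / d / b) ^ L := by
    intro k _
    rw [Polynomial.eval_mul, Polynomial.eval_pow, norm_mul, norm_pow]
    rcases hv k with h | h
    · rw [h, norm_zero, zero_mul]
      positivity
    · gcongr
      · exact hA _ (by simp [hζ1])
      · rw [eval_damping, norm_div, Complex.norm_natCast]
        gcongr
        exact norm_geom_sum_le (by simp [hζ1, hz]) hd h b
  refine (Finset.sum_le_sum h2).trans ?_
  rw [Finset.sum_const, Finset.card_range, nsmul_eq_mul]

/-! ### Exponential decay of the eigenvalues -/

/-- The polynomial with coefficient vector `v`. -/
noncomputable def vecPoly {N : ℕ} (v : Fin N → ℂ) : Polynomial ℂ :=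
  ∑ n : Fin N, Polynomial.monomial (n : ℕ) (v n)

theorem natDegree_vecPoly_lt {N : ℕ} (hN : 0 < N) (v : Fin N → ℂ) :
    (vecPoly v).natDegree < N := by
  have h : (vecPoly v).natDegree ≤ N - 1 := by
    unfold vecPoly
    refine Polynomial.natDegree_sum_le_of_forall_le _ _ fun i _ => ?_
    refine (Polynomial.natDegree_monomial_le _).trans ?_
    have := i.2
    omega
  omega

theorem eval_vecPoly {N : ℕ} (v : Fin N → ℂ) (f : ℝ) :
    (vecPoly v).eval (Complex.exp (-(2 * Real.pi * f * Complex.I))) = vecDtft v f := by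
  unfold vecPoly vecDtft
  rw [Polynomial.eval_finsetSum]
  refine Finset.sum_congr rfl fun n _ => ?_
  rw [Polynomial.eval_monomial, ← Complex.exp_nat_mul]
  congr 2
  ring

theorem norm_eval_vecPoly_le {N : ℕ} (v : Fin N → ℂ) {w : ℂ} (hw : ‖w‖ = 1) :
    ‖(vecPoly v).eval w‖ ≤ √(N * ∑ n, ‖v n‖ ^ 2) := by
  have h1 : ‖(vecPoly v).eval w‖ ≤ ∑ n, ‖v n‖ := by
    unfold vecPoly
    rw [Polynomial.eval_finsetSum]
    refine (norm_sum_le _ _).trans (Finset.sum_le_sum fun n _ => ?_)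
    rw [Polynomial.eval_monomial, norm_mul, norm_pow, hw, one_pow, mul_one]
  refine h1.trans (Real.le_sqrt_of_sq_le ?_)
  simpa using sq_sum_le_card_mul_sum_sq (s := Finset.univ) (f := fun n => ‖v n‖)

theorem vecDtft_add_int {N : ℕ} (v : Fin N → ℂ) (f : ℝ) (m : ℤ) :
    vecDtft v (f + m) = vecDtft v f := by
  rw [← eval_vecPoly, ← eval_vecPoly]
  congr 1
  rw [Complex.exp_eq_exp_iff_exists_int]
  refine ⟨-m, ?_⟩
  push_cast
  ring

/-- A DTFT that vanishes on the part of the grid `ℤ / M` in a neighbourhood of the band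
`[-W, W]` is exponentially small on the band. -/
theorem norm_vecDtft_le_of_vanish {N b L M : ℕ} (hN : 0 < N) (hb : 0 < b)
    (hM : M = N + (b - 1) * L) {W η : ℝ} (hη : 0 < η) (v : Fin N → ℂ)
    (hv : ∀ j : ℤ, |(j : ℝ)| ≤ M * (W + η) → vecDtft v (j / M) = 0) {f : ℝ} (hf : |f| ≤ W) :
    ‖vecDtft v f‖ ≤ M * (√(N * ∑ n, ‖v n‖ ^ 2) * (2 / (4 * η) / b) ^ L) := by
  have hM0 : M ≠ 0 := by omega
  have hMpos : (0 : ℝ) < M := by exact_mod_cast Nat.pos_of_ne_zero hM0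
  have hMC : (M : ℂ) ≠ 0 := by exact_mod_cast hM0
  -- The inverse root matches the sign convention: `vecDtft v f` is the value of `vecPoly v` at
  -- `e^{-2πif}`.
  have hζ := (Complex.isPrimitiveRoot_exp M hM0).inv
  have hpow : ∀ k : ℕ, (Complex.exp (2 * Real.pi * Complex.I / M))⁻¹ ^ k =
      Complex.exp (-(2 * Real.pi * ((k / M : ℝ) : ℂ) * Complex.I)) := by
    intro k
    rw [← Complex.exp_neg, ← Complex.exp_nat_mul]
    congr 1
    push_cast
    ring
  rw [← eval_vecPoly]
  refine norm_eval_le_of_vanish hb hM hζ (natDegree_vecPoly_lt hN v) ?_ (by positivity)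
    (fun w hw => norm_eval_vecPoly_le v hw) ?_
  · rw [Complex.norm_exp]
    simp
  · intro k
    rw [hpow, eval_vecPoly, ← Complex.exp_sub]
    by_cases hk : ∀ m : ℤ, η ≤ |(f - k / M) - m|
    · right
      convert le_norm_exp_sub_one hk using 4
      push_cast
      ring
    · left
      push Not at hk
      obtain ⟨m, hm⟩ := hk
      have h1 : ((k + m * M : ℤ) : ℝ) / M = k / M + m := by
        push_cast
        field_simp
      -- By periodicity the grid point is moved to its representative within `η` of `f`, where the
      -- vanishing hypothesis applies.
      rw [← vecDtft_add_int v _ m, ← h1]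
      apply hv
      have h2 : ((k + m * M : ℤ) : ℝ) = M * (k / M + m) := by
        rw [← h1]
        field_simp
      rw [h2, abs_mul, abs_of_pos hMpos]
      gcongr
      rw [abs_lt] at hm
      rw [abs_le] at hf ⊢
      constructor <;> linarith [hf.1, hf.2, hm.1, hm.2]

/-- Dimension count: there are `m + (N - 1 - l) < N` linear conditions on `N` coefficients. -/
theorem exists_vecDtft_eq_zero {N m : ℕ} (u : Fin N → Fin N → ℂ) (t : Fin m → ℝ) (l : Fin N)
    (hm : m ≤ l) : ∃ c : Fin N → ℂ, c ≠ 0 ∧ (∀ i, l < i → c i = 0) ∧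
      ∀ j, vecDtft (fun n => ∑ i, c i * u i n) (t j) = 0 := by
  set F : (Fin N → ℂ) →ₗ[ℂ] (Fin m → ℂ) × ({i : Fin N // l < i} → ℂ) :=
    { toFun := fun c => (fun j => ∑ i, c i * vecDtft (u i) (t j), fun i => c i)
      map_add' := by
        intro c c'
        ext j
        · simp only [Pi.add_apply, add_mul, Finset.sum_add_distrib, Prod.mk_add_mk]
        · rfl
      map_smul' := by
        intro a c
        ext j
        · simp only [Pi.smul_apply, smul_eq_mul, mul_assoc, ← Finset.mul_sum,
            Prod.smul_mk, RingHom.id_apply]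
        · rfl } with hF
  have hker : LinearMap.ker F ≠ ⊥ := by
    apply LinearMap.ker_ne_bot_of_finrank_lt
    rw [Module.finrank_prod, Module.finrank_fin_fun, Module.finrank_fin_fun,
      Module.finrank_fintype_fun_eq_card, Fintype.card_subtype]
    have h1 : (Finset.univ.filter fun i => l < i) = Finset.Ioi l := by
      ext
      simp
    rw [h1, Fin.card_Ioi]
    have := l.2
    omega
  obtain ⟨c, hc, hc0⟩ := (Submodule.ne_bot_iff _).1 hker
  rw [LinearMap.mem_ker] at hc
  exact ⟨c, hc0, fun i hi => congrFun (congrArg Prod.snd hc) ⟨i, hi⟩,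
    fun j => (vecDtft_sum c u (t j)).trans (congrFun (congrArg Prod.fst hc) j)⟩

/-- Min-max: on the span of the vectors `0, …, l` the fraction of energy in the band is at least
`lam l`, so one nonzero element with little energy in the band suffices. The hypothesis on `l`
counts the grid points within `η` of the band. -/
theorem IsDPSS.lam_le {N : ℕ} {W : ℝ} {s : Fin N → ℤ → ℝ} {lam : Fin N → ℝ}
    (h : IsDPSS N W s lam) (hW : 0 < W) {b L M : ℕ} (hb : 0 < b) (hM : M = N + (b - 1) * L)
    {η : ℝ} (hη : 0 < η) (l : Fin N) (hl : 2 * ⌊M * (W + η)⌋₊ + 1 ≤ (l : ℕ)) :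
    lam l ≤ 2 * W * (M ^ 2 * N * (2 / (4 * η) / b) ^ (2 * L)) := by
  set J := ⌊M * (W + η)⌋₊ with hJ
  -- The shift by `J` lets the indices `0, …, 2 * J` enumerate the grid points `-J, …, J`.
  obtain ⟨c, hc0, hcl, hc⟩ := exists_vecDtft_eq_zero (fun i (n : Fin N) => (s i n : ℂ))
    (fun i : Fin (2 * J + 1) => (((i : ℕ) : ℝ) - J) / M) l hl
  set v : Fin N → ℂ := fun n => ∑ i, c i * (s i n : ℂ) with hv
  have hvan : ∀ j : ℤ, |(j : ℝ)| ≤ M * (W + η) → vecDtft v (j / M) = 0 := by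
    intro j hj
    have h1 : j.natAbs ≤ J := by
      rw [hJ, Nat.le_floor_iff (by positivity), Nat.cast_natAbs, Int.cast_abs]
      exact hj
    have h2 : (j + J).toNat < 2 * J + 1 := by omega
    have h3 := hc ⟨_, h2⟩
    have h4 : (((j + J).toNat : ℕ) : ℝ) = j + J := by
      have h5 : (((j + J).toNat : ℕ) : ℤ) = j + J := Int.toNat_of_nonneg (by omega)
      exact_mod_cast h5
    simpa only [h4, add_sub_cancel_right] using h3
  set B : ℝ := M * (√(N * ∑ n, ‖v n‖ ^ 2) * (2 / (4 * η) / b) ^ L) with hB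
  have hbound : ∀ f ∈ Set.Icc (-W) W, ‖vecDtft v f‖ ^ 2 ≤ B ^ 2 := by
    intro f hf
    have hN : 0 < N := l.pos
    have := norm_vecDtft_le_of_vanish hN hb hM hη v hvan (abs_le.2 hf)
    gcongr
  have hint : ∫ f in (-W)..W, ‖vecDtft v f‖ ^ 2 ≤ 2 * W * B ^ 2 := by
    have h1 := intervalIntegral.integral_mono_on (a := -W) (b := W)
      (μ := MeasureTheory.volume) (by linarith)
      (((continuous_vecDtft v).norm.pow 2).intervalIntegrable _ _)
      ((continuous_const (y := B ^ 2)).intervalIntegrable _ _) hbound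
    simp only [intervalIntegral.integral_const, smul_eq_mul, Pi.pow_apply] at h1
    linarith
  have hB2 : B ^ 2 = (M ^ 2 * N * (2 / (4 * η) / b) ^ (2 * L)) * ∑ n, ‖v n‖ ^ 2 := by
    rw [hB, mul_pow, mul_pow, Real.sq_sqrt (by positivity), ← pow_mul, mul_comm L 2]
    ring
  rw [h.integral_norm_sq, hB2, h.sum_norm_sq] at hint
  have hle : lam l * ∑ i, ‖c i‖ ^ 2 ≤ ∑ i, lam i * ‖c i‖ ^ 2 := by
    rw [Finset.mul_sum]
    refine Finset.sum_le_sum fun i _ => ?_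
    by_cases hi : l < i
    · simp [hcl i hi]
    · gcongr
      exact h.antitone (not_lt.1 hi)
  have hpos : 0 < ∑ i, ‖c i‖ ^ 2 := by
    obtain ⟨i, hi⟩ := Function.ne_iff.1 hc0
    refine Finset.sum_pos' (fun i _ => by positivity) ⟨i, Finset.mem_univ i, ?_⟩
    have : 0 < ‖c i‖ := norm_pos_iff.2 hi
    positivity
  refine le_of_mul_le_mul_right ?_ hpos
  linarith

theorem exists_exp_decay {W ε : ℝ} (hW : 0 < W) (hW2 : W < 1 / 2) (hε : 0 < ε) :
    ∃ κ : ℝ, 0 < κ ∧ ∃ N₁ : ℕ, ∀ N : ℕ, N₁ ≤ N → ∀ (s : Fin N → ℤ → ℝ) (lam : Fin N → ℝ),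
      IsDPSS N W s lam → ∀ l : Fin N, 2 * (N : ℝ) * W * (1 + ε) ≤ ((l : ℕ) : ℝ) →
        lam l ≤ Real.exp (-(κ * (N : ℝ))) := by
  set η : ℝ := W * ε / 4 with hη
  have hη0 : 0 < η := by positivity
  -- Chosen so that each damping factor contributes at most `e⁻¹` at distance `η` or more.
  set b : ℕ := ⌈Real.exp 1 / (2 * η)⌉₊ with hb
  have hb0 : 0 < b := Nat.ceil_pos.2 (by positivity)
  have hbR : (0 : ℝ) < b := by exact_mod_cast hb0
  have hr : 2 / (4 * η) / b ≤ Real.exp (-1) := by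
    have h1 : Real.exp 1 / (2 * η) ≤ b := Nat.le_ceil _
    rw [div_le_iff₀ (by positivity)] at h1
    rw [Real.exp_neg, div_div, div_le_iff₀ (by positivity), inv_mul_eq_div,
      le_div_iff₀ (Real.exp_pos 1)]
    linarith
  -- With `L ≈ κ N` the grid grows by a factor at most `1 + ε / (4 + ε)`, and `(1 + ε / (4 + ε)) *
  -- (1 + ε / 4) = 1 + ε / 2`: half of the margin `ε` is used.
  set κ : ℝ := ε / (b * (4 + ε)) with hκ
  have hκ0 : 0 < κ := by positivity
  -- The bound decays like `e^{-2κN}`; one factor `e^{-κN}` absorbs `M ^ 2 * N` and the `e ^ 2` lost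
  -- in rounding `L` down.
  have hexp : ∀ᶠ N : ℕ in Filter.atTop,
      4 * Real.exp 2 * (N : ℝ) ^ 3 ≤ Real.exp (κ * N) := by
    have h1 := (isLittleO_pow_exp_pos_mul_atTop 3 hκ0).bound
      (c := (4 * Real.exp 2)⁻¹) (by positivity)
    filter_upwards [tendsto_natCast_atTop_atTop.eventually h1] with N hN
    rw [Real.norm_of_nonneg (by positivity), Real.norm_of_nonneg (by positivity),
      inv_mul_eq_div, le_div_iff₀ (by positivity)] at hN
    linarith
  obtain ⟨N₂, hN₂⟩ := Filter.eventually_atTop.1 hexp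
  refine ⟨κ, hκ0, max N₂ ⌈1 / (W * ε)⌉₊, fun N hN s lam h l hl => ?_⟩
  -- The second threshold gives `N W ε ≥ 1`, so the unused half of the margin covers the `+ 1` in
  -- the count of grid points.
  have hN1 := hN₂ N ((le_max_left _ _).trans hN)
  have hN2 : 1 ≤ N * (W * ε) := by
    rw [← div_le_iff₀ (by positivity)]
    exact Nat.ceil_le.1 ((le_max_right _ _).trans hN)
  set L : ℕ := ⌊κ * N⌋₊ with hL
  set M : ℕ := N + (b - 1) * L with hM
  have hL1 : (L : ℝ) ≤ κ * N := Nat.floor_le (by positivity)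
  have hL2 : κ * N - 1 < L := Nat.sub_one_lt_floor _
  have hMle : (M : ℝ) ≤ N * (1 + ε / (4 + ε)) := by
    have h1 : M ≤ N + b * L := by
      rw [hM]
      gcongr
      omega
    have h2 : (M : ℝ) ≤ N + b * L := by exact_mod_cast h1
    have h3 : (b : ℝ) * L ≤ b * (κ * N) := by gcongr
    have h4 : (b : ℝ) * (κ * N) = N * (ε / (4 + ε)) := by
      rw [hκ]
      field_simp
    linarith
  have hcount : 2 * ⌊M * (W + η)⌋₊ + 1 ≤ (l : ℕ) := by
    have h1 : (⌊M * (W + η)⌋₊ : ℝ) ≤ M * (W + η) := Nat.floor_le (by positivity)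
    have h2 : (M : ℝ) * (W + η) ≤ N * (1 + ε / (4 + ε)) * (W + η) := by gcongr
    have h3 : (N : ℝ) * (1 + ε / (4 + ε)) * (W + η) = N * W * (1 + ε / 2) := by
      rw [hη]
      field_simp
      ring
    have h4 : ((2 * ⌊M * (W + η)⌋₊ + 1 : ℕ) : ℝ) ≤ (l : ℕ) := by
      push_cast
      linarith
    exact_mod_cast h4
  have hM2 : (M : ℝ) ≤ 2 * N := by
    have h1 : ε / (4 + ε) ≤ 1 := by
      rw [div_le_one (by positivity)]
      linarith
    nlinarith [(Nat.cast_nonneg N : (0 : ℝ) ≤ N)]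
  have hpow : (2 / (4 * η) / b) ^ (2 * L) ≤ Real.exp 2 * Real.exp (-(κ * N)) ^ 2 := by
    calc (2 / (4 * η) / b) ^ (2 * L) ≤ Real.exp (-1) ^ (2 * L) := by gcongr
      _ = Real.exp (-(2 * L)) := by
        rw [← Real.exp_nat_mul]
        push_cast
        ring_nf
      _ ≤ Real.exp (2 + -(2 * (κ * N))) := by
        gcongr
        linarith
      _ = _ := by
        rw [Real.exp_add, ← Real.exp_nat_mul]
        push_cast
        ring_nf
  calc lam l ≤ 2 * W * (M ^ 2 * N * (2 / (4 * η) / b) ^ (2 * L)) :=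
        h.lam_le hW hb0 hM hη0 l hcount
    _ ≤ 1 * ((2 * N) ^ 2 * N * (Real.exp 2 * Real.exp (-(κ * N)) ^ 2)) := by
        gcongr
        linarith
    _ = (4 * Real.exp 2 * (N : ℝ) ^ 3) * Real.exp (-(κ * N)) ^ 2 := by ring
    _ ≤ Real.exp (κ * N) * Real.exp (-(κ * N)) ^ 2 := by gcongr
    _ = Real.exp (-(κ * N)) := by
        rw [sq, ← mul_assoc, ← Real.exp_add, add_neg_cancel, Real.exp_zero, one_mul]

/-! ### Energy in the band and approximation error -/

theorem dtft_timeLimit (N : ℕ) (x : ℤ → ℂ) (f : ℝ) :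
    dtft (timeLimit N x) f = vecDtft (fun n : Fin N => x n) f := by
  unfold dtft vecDtft
  rw [tsum_timeLimit N]
  · refine Finset.sum_congr rfl fun n _ => ?_
    have : (0 : ℤ) ≤ n ∧ (n : ℤ) < N := by have := n.2; omega
    simp only [timeLimit, this, and_self, if_true]
    push_cast
    rfl
  · intro n hn
    simp [timeLimit, hn]

/-- Parseval on the period centred at `fc`: since `2 * W < 1` the band fits inside it, and the left
side lists the Fourier coefficients of `X` cut off to the band, in reversed order. -/
theorem energy_integral_exp {X : ℝ → ℂ} (hX : Continuous X) {fc W : ℝ} (hW0 : 0 < W)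
    (hW : W < 1 / 2) :
    energy (fun n => ∫ f in (fc - W)..(fc + W), X f *
      Complex.exp (2 * Real.pi * f * n * Complex.I)) =
      ∫ f in (fc - W)..(fc + W), ‖X f‖ ^ 2 := by
  have hab : fc - 1 / 2 < fc + 1 / 2 := by linarith
  have hsub : Set.Ioc (fc - W) (fc + W) ⊆ Set.Ioc (fc - 1 / 2) (fc + 1 / 2) :=
    Set.Ioc_subset_Ioc (by linarith) (by linarith)
  have hind : ∀ {E : Type} [NormedAddCommGroup E] [NormedSpace ℝ E] (g : ℝ → E),
      ∫ f in (fc - 1 / 2)..(fc + 1 / 2), (Set.Ioc (fc - W) (fc + W)).indicator g f =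
        ∫ f in (fc - W)..(fc + W), g f := by
    intro E _ _ g
    rw [intervalIntegral.integral_of_le hab.le, intervalIntegral.integral_of_le (by linarith),
      MeasureTheory.setIntegral_indicator measurableSet_Ioc, Set.inter_eq_self_of_subset_right hsub]
  set F := (Set.Ioc (fc - W) (fc + W)).indicator X with hF
  have hmem : MeasureTheory.MemLp F 2
      (MeasureTheory.volume.restrict (Set.Ioc (fc - 1 / 2) (fc + 1 / 2))) := by
    apply MeasureTheory.MemLp.indicator measurableSet_Ioc
    obtain ⟨C, hC⟩ := isCompact_Icc.exists_bound_of_continuousOn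
      (hX.continuousOn (s := Set.Icc (fc - 1 / 2) (fc + 1 / 2)))
    exact MeasureTheory.MemLp.of_bound hX.aestronglyMeasurable C
      (MeasureTheory.ae_restrict_of_forall_mem measurableSet_Ioc
        fun f hf => hC f (Set.Ioc_subset_Icc_self hf))
  have hcoef : ∀ n : ℤ, fourierCoeffOn hab F (-n) = ∫ f in (fc - W)..(fc + W), X f *
      Complex.exp (2 * Real.pi * f * n * Complex.I) := by
    intro n
    rw [fourierCoeffOn_eq_integral, ← hind]
    have h1 : fc + 1 / 2 - (fc - 1 / 2) = 1 := by ring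
    rw [h1, div_one, one_smul]
    congr 1
    ext f
    rw [neg_neg, fourier_coe_apply, hF, Set.indicator_apply, Set.indicator_apply]
    split_ifs
    · rw [smul_eq_mul, mul_comm]
      congr 2
      push_cast
      ring
    · simp
  have hsum := tsum_sq_fourierCoeffOn hab hmem
  have h1 : fc + 1 / 2 - (fc - 1 / 2) = 1 := by ring
  rw [h1, inv_one, one_smul, ← (Equiv.neg ℤ).tsum_eq] at hsum
  simp only [Equiv.neg_apply, hcoef] at hsum
  unfold energy
  rw [hsum, ← hind]
  congr 1
  ext f
  rw [hF, Set.indicator_apply, Set.indicator_apply]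
  split_ifs <;> simp

/-- Demodulation by `fc` translates the band to `[-W, W]`, where the DPSS quadratic form applies. -/
theorem energy_bandLimit (N : ℕ) {fc W : ℝ} (hW0 : 0 < W) (hW : W < 1 / 2) (x : ℤ → ℂ) :
    energy (bandLimit fc W (timeLimit N x)) = ∫ f in (-W)..W, ‖vecDtft (fun n : Fin N =>
      Complex.exp (-(2 * Real.pi * fc * (n : ℕ) * Complex.I)) * x n) f‖ ^ 2 := by
  unfold bandLimit
  simp only [dtft_timeLimit]
  rw [energy_integral_exp (continuous_vecDtft _) hW0 hW]
  have h1 := intervalIntegral.integral_comp_add_right (a := -W) (b := W)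
    (fun f => ‖vecDtft (fun n : Fin N => x n) f‖ ^ 2) fc
  rw [neg_add_eq_sub, add_comm W fc] at h1
  rw [← h1]
  congr 1
  ext f
  congr 2
  unfold vecDtft
  refine Finset.sum_congr rfl fun n _ => ?_
  dsimp only
  rw [mul_comm (Complex.exp _) (x n), mul_assoc (x n), ← Complex.exp_add]
  congr 2
  push_cast
  ring

theorem IsDPSS.exists_expansion {N : ℕ} {W : ℝ} {s : Fin N → ℤ → ℝ} {lam : Fin N → ℝ}
    (h : IsDPSS N W s lam) (y : Fin N → ℂ) :
    ∃ c : Fin N → ℂ, y = fun n : Fin N => ∑ l, c l * (s l n : ℂ) := by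
  set A : Matrix (Fin N) (Fin N) ℂ := Matrix.of fun l n => (s l n : ℂ) with hA
  have h1 : A * A.transpose = 1 := by
    ext l l'
    rw [Matrix.mul_apply, Matrix.one_apply]
    have h2 := congrArg (fun r : ℝ => (r : ℂ)) (h.sum_mul l l')
    simp only [Complex.ofReal_sum, Complex.ofReal_mul] at h2
    simp only [hA, Matrix.transpose_apply, Matrix.of_apply, h2]
    split_ifs <;> simp
  -- For a square matrix, orthonormal rows already give completeness.
  have h2 := mul_eq_one_comm.1 h1
  refine ⟨Matrix.mulVec A y, ?_⟩
  have h3 : Matrix.mulVec A.transpose (Matrix.mulVec A y) = y := by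
    rw [Matrix.mulVec_mulVec, h2, Matrix.one_mulVec]
  conv_lhs => rw [← h3]
  funext n
  rw [Matrix.mulVec, dotProduct]
  exact Finset.sum_congr rfl fun l _ => mul_comm _ _

theorem norm_exp_neg_modulation (fc : ℝ) (n : ℕ) :
    ‖Complex.exp (-(2 * Real.pi * fc * n * Complex.I))‖ = 1 := by
  rw [Complex.norm_exp]
  simp

/-- The modulated expansion truncated at `k` lies in the column space, so the projection does at
least as well. Modulation preserves moduli, which leaves the energy of the tail. -/
theorem norm_restrict_sub_starProjection_sq_le {N : ℕ} {W : ℝ} {s : Fin N → ℤ → ℝ}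
    {lam : Fin N → ℝ} (h : IsDPSS N W s lam) (fc : ℝ) (x : ℤ → ℂ) (c : Fin N → ℂ)
    (hc : (fun n : Fin N => Complex.exp (-(2 * Real.pi * fc * (n : ℕ) * Complex.I)) * x n) =
      fun n : Fin N => ∑ l, c l * (s l n : ℂ)) (k : ℕ) :
    ‖restrict N x - (firstColumnsSpan (modulator N fc * dpssMatrix s) k).starProjection
      (restrict N x)‖ ^ 2 ≤ ∑ l : Fin N, if (l : ℕ) < k then 0 else ‖c l‖ ^ 2 := by
  set u : Fin N → EuclideanSpace ℂ (Fin N) :=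
    fun l => WithLp.toLp 2 ((modulator N fc * dpssMatrix s).col l) with hu
  set w : EuclideanSpace ℂ (Fin N) := ∑ l : Fin N, if (l : ℕ) < k then c l • u l else 0 with hw
  have hwmem : w ∈ firstColumnsSpan (modulator N fc * dpssMatrix s) k := by
    refine Submodule.sum_mem _ fun l _ => ?_
    split_ifs with hl
    · exact Submodule.smul_mem _ _ (Submodule.subset_span ⟨l, hl, rfl⟩)
    · exact Submodule.zero_mem _
  have hmin : ‖restrict N x - (firstColumnsSpan (modulator N fc * dpssMatrix s) k).starProjection
      (restrict N x)‖ ≤ ‖restrict N x - w‖ := by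
    rw [Submodule.starProjection_minimal]
    exact ciInf_le (f := fun a : firstColumnsSpan (modulator N fc * dpssMatrix s) k =>
      ‖restrict N x - a‖) ⟨0, by rintro _ ⟨a, rfl⟩; exact norm_nonneg _⟩ ⟨w, hwmem⟩
  have hwn : ∀ n : Fin N, w n = Complex.exp (2 * Real.pi * fc * (n : ℕ) * Complex.I) *
      ∑ l : Fin N, if (l : ℕ) < k then c l * (s l n : ℂ) else 0 := by
    intro n
    rw [hw, WithLp.ofLp_sum, Finset.sum_apply, Finset.mul_sum]
    refine Finset.sum_congr rfl fun l _ => ?_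
    split_ifs
    · simp only [hu, PiLp.smul_apply, Matrix.col_apply, modulator, Matrix.diagonal_mul, dpssMatrix,
        Matrix.of_apply, smul_eq_mul]
      ring
    · simp
  have hn : ∀ n : Fin N, ‖(restrict N x - w) n‖ =
      ‖∑ l : Fin N, (if (l : ℕ) < k then 0 else c l) * (s l n : ℂ)‖ := by
    intro n
    have h1 : Complex.exp (-(2 * Real.pi * fc * (n : ℕ) * Complex.I)) * (restrict N x - w) n =
        ∑ l : Fin N, (if (l : ℕ) < k then 0 else c l) * (s l n : ℂ) := by
      rw [PiLp.sub_apply, mul_sub, hwn, ← mul_assoc, ← Complex.exp_add, neg_add_cancel,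
        Complex.exp_zero, one_mul, show restrict N x n = x n from rfl]
      rw [show Complex.exp (-(2 * Real.pi * fc * (n : ℕ) * Complex.I)) * x n = _ from
        congrFun hc n, ← Finset.sum_sub_distrib]
      refine Finset.sum_congr rfl fun l _ => ?_
      split_ifs <;> simp
    rw [← h1, norm_mul, norm_exp_neg_modulation, one_mul]
  calc _ ≤ ‖restrict N x - w‖ ^ 2 := by gcongr
    _ = ∑ n : Fin N, ‖∑ l : Fin N, (if (l : ℕ) < k then 0 else c l) * (s l n : ℂ)‖ ^ 2 := by
        rw [EuclideanSpace.norm_sq_eq]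
        simp only [hn]
    _ = _ := by
        rw [h.sum_norm_sq]
        refine Finset.sum_congr rfl fun l _ => ?_
        split_ifs <;> simp

theorem approximation_error_le {N : ℕ} {W : ℝ} (hW0 : 0 < W) (hW : W < 1 / 2)
    {s : Fin N → ℤ → ℝ} {lam : Fin N → ℝ} (h : IsDPSS N W s lam) {k : ℕ} {τ : ℝ}
    (hτ : ∀ l : Fin N, k ≤ (l : ℕ) → lam l ≤ τ) (hτ0 : 0 ≤ τ) (fc δ : ℝ) (x : ℤ → ℂ)
    (hx : timeLimit N x = x) (hδ : (1 - δ) * energy x ≤ energy (bandLimit fc W x)) :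
    ‖restrict N x - (firstColumnsSpan (modulator N fc * dpssMatrix s) k).starProjection
      (restrict N x)‖ ^ 2 ≤ (δ + τ) * ‖restrict N x‖ ^ 2 := by
  obtain ⟨c, hc⟩ := h.exists_expansion
    (fun n : Fin N => Complex.exp (-(2 * Real.pi * fc * (n : ℕ) * Complex.I)) * x n)
  refine (norm_restrict_sub_starProjection_sq_le h fc x c hc k).trans ?_
  have hband : energy (bandLimit fc W x) = ∑ l, lam l * ‖c l‖ ^ 2 := by
    rw [← hx, energy_bandLimit N hW0 hW, hc, h.integral_norm_sq]
  have hx2 : ∑ n : Fin N, ‖x n‖ ^ 2 = ∑ l, ‖c l‖ ^ 2 := by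
    rw [← h.sum_norm_sq c]
    refine Finset.sum_congr rfl fun n _ => ?_
    rw [← congrFun hc n, norm_mul, norm_exp_neg_modulation, one_mul]
  have hres : ‖restrict N x‖ ^ 2 = ∑ l, ‖c l‖ ^ 2 := by
    rw [EuclideanSpace.norm_sq_eq, ← hx2]
    rfl
  have hen : energy x = ∑ l, ‖c l‖ ^ 2 := by
    rw [← hx, energy_timeLimit, hx2]
  rw [hband, hen] at hδ
  rw [hres]
  -- Summed over `l`, this bounds tail plus band energy by `1 + τ` times the total; the band energy
  -- is at least `1 - δ` times the total. Indices below `k` need only `lam l < 1`.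
  have hle : ∀ l : Fin N, (if (l : ℕ) < k then 0 else ‖c l‖ ^ 2) + lam l * ‖c l‖ ^ 2 ≤
      ‖c l‖ ^ 2 + τ * ‖c l‖ ^ 2 := by
    intro l
    have h0 : 0 ≤ ‖c l‖ ^ 2 := by positivity
    split_ifs with hl
    · nlinarith [h.lt_one l]
    · nlinarith [hτ l (not_lt.1 hl)]
  have hsum := Finset.sum_le_sum fun (l : Fin N) (_ : l ∈ Finset.univ) => hle l
  rw [Finset.sum_add_distrib, Finset.sum_add_distrib, ← Finset.mul_sum] at hsum
  linarith

end DPSS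

theorem mainTheorem6 :
    ∃ C₃ : ℝ, 0 < C₃ ∧
      ∀ W ε : ℝ, 0 < W → W < 1 / 2 → 0 < ε → ε < 1 / (2 * W) - 1 →
        ∃ C₄ : ℝ, 0 < C₄ ∧ ∃ N₁ : ℕ, ∀ N : ℕ, N₁ ≤ N →
          ∀ (s : Fin N → ℤ → ℝ) (lam : Fin N → ℝ), DPSS.IsDPSS N W s lam →
            -- the constants bound the eigenvalues that cluster near zero
            (∀ l : Fin N, 2 * (N : ℝ) * W * (1 + ε) ≤ ((l : ℕ) : ℝ) →
              lam l ≤ C₃ * Real.exp (-(C₄ * (N : ℝ)))) ∧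
            -- and, with the same constants, the approximation error
            (∀ (fc δ : ℝ) (x : ℤ → ℂ), DPSS.timeLimit N x = x →
              (1 - δ) * DPSS.energy x ≤ DPSS.energy (DPSS.bandLimit fc W x) →
              ∀ (k : ℕ), k = ⌈2 * (N : ℝ) * W * (1 + ε)⌉₊ →
              ∀ (Q : Submodule ℂ (EuclideanSpace ℂ (Fin N))),
                Q = DPSS.firstColumnsSpan (DPSS.modulator N fc * DPSS.dpssMatrix s) k →
                ‖DPSS.restrict N x - Q.starProjection (DPSS.restrict N x)‖ ^ 2 ≤
                  (δ + (N : ℝ) * C₃ * Real.exp (-(C₄ * (N : ℝ)))) *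
                    ‖DPSS.restrict N x‖ ^ 2) := by
  refine ⟨1, one_pos, fun W ε hW0 hW hε _ => ?_⟩
  obtain ⟨κ, hκ, N₁, hN₁⟩ := DPSS.exists_exp_decay hW0 hW hε
  refine ⟨κ, hκ, N₁, fun N hN s lam h => ⟨fun l hl => ?_, ?_⟩⟩
  · rw [one_mul]
    exact hN₁ N hN s lam h l hl
  · rintro fc δ x hx hδ k rfl Q rfl
    refine DPSS.approximation_error_le hW0 hW h (fun l hl => ?_) (by positivity) fc δ x hx hδ
    have hN1 : (1 : ℝ) ≤ N := by exact_mod_cast l.pos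
    refine (hN₁ N hN s lam h l (Nat.ceil_le.1 hl)).trans ?_
    rw [mul_one]
    -- The uniform bound on the small eigenvalues suffices; the factor `N` in the claim is slack.
    exact le_mul_of_one_le_left (Real.exp_pos _).le hN1
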